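/- Let $\{u_n\}_{n\ge 0}$ be one of the following $15$ Apéry-like sequences (six of Zagier, six of Almkvist–Zudilin, three of Cooper), where $\binom{m}{k}=0$ whenever $m<0$ or $k>m$: - $(\mathbf{A})$ $u_n=\sum_{k=0}^n\binom nk^3$; - $(\mathbf{B})$ $u_n=\sum_{k=0}^n(-1)^k3^{n-3k}\binom n{3k}\binom{3k}{2k}\binom{2k}k$; - $(\mathbf{C})$ $u_n=\sum_{k=0}^n\binom nk^2\binom{2k}k$; - $(\mathbf{D})$ $u_n=\sum_{k=0}^n\binom nk^2\binom{n+k}k$; - $(\mathbf{E})$ $u_n=\sum_{k=0}^n4^{n-2k}\binom n{2k}\binom{2k}k^2$; - $(\mathbf{F})$ $u_n=\sum_{k=0}^n(-1)^k8^{n-k}\binom nk\sum_{j=0}^k\binom kj^3$; - $(\delta)$ $u_n=\sum_{k=0}^n(-1)^k3^{n-3k}\binom n{3k}\binom{n+k}k\binom{3k}{2k}\binom{2k}k$; - $(\eta)$ $u_n=\sum_{k=0}^n(-1)^k\binom nk^3\left(\binom{4n-5k-1}{3n}+\binom{4n-5k}{3n}\right)$; - $(\alpha)$ $u_n=\sum_{k=0}^n\binom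 nk^2\binom{2k}k\binom{2n-2k}{n-k}$; - $(\epsilon)$ $u_n=\sum_{k=0}^n\binom nk^2\binom{2k}n^2$; - $(\zeta)$ $u_n=\sum_{k=0}^n\sum_{l=0}^n\binom nk^2\binom nl\binom kl\binom{k+l}n$; - $(\gamma)$ $u_n=\sum_{k=0}^n\binom nk^2\binom{n+k}k^2$; - $(s_7)$ $u_n=\sum_{k=0}^n\binom nk^2\binom{n+k}k\binom{2k}n$; - $(s_{10})$ $u_n=\sum_{k=0}^n\binom nk^4$; - $(s_{18})$ $u_n=\sum_{k=0}^n(-1)^k\binom nk\binom{2k}k\binom{2n-2k}{n-k}\left(\binom{2n-3k-1}n+\binom{2n-3k}n\right)$. Let $\alpha$ be an integer and let $v_n(\alpha)=\sum_{k=0}^n\binom nk(-\alpha)^{n-k}u_k$ $(n\ge 0)$ be the binomial transform of $\{u_n\}_{n\ge 0}$. Then $\{v_n(\alpha)\}_{n\ge 0}$ satisfies the Gauss congruences $$v_{np^k}(\alpha)\equiv v_{np^{k-1}}(\alpha)\pmod{p^k}$$ for all primes $p$ and all positive integers $n,k$. -/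

import Mathlib

open Finset

/-- Labels of the fifteen sporadic Apéry-like sequences: Zagier's six (second kind),
the six of Almkvist and Zudilin, and Cooper's three (first kind). -/
inductive AperyLike : Type
  | A | B | C | D | E | F
  | delta | eta | alpha | epsilon | zeta | gamma
  | s7 | s10 | s18

/-- The binomial coefficient with an integer upper argument `m`, with the convention that it
vanishes when `m` is negative. -/
def intBinom (m : ℤ) (k : ℕ) : ℤ :=
  if 0 ≤ m then (m.toNat.choose k : ℤ) else 0

/-- The Apéry-like sequences. Wherever a natural number subtraction in an exponent truncates
(`n < 3 * k` in `B` and `delta`, `n < 2 * k` in `E`), the binomial coefficient next to it is zero.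
In `eta` and `s18` the upper arguments are formed in `ℤ`. -/
def AperyLike.seq : AperyLike → ℕ → ℤ
  | .A, n => ∑ k ∈ range (n + 1), (n.choose k : ℤ) ^ 3
  | .B, n => ∑ k ∈ range (n + 1), (-1) ^ k * 3 ^ (n - 3 * k) *
      (n.choose (3 * k) : ℤ) * ((3 * k).choose (2 * k) : ℤ) * ((2 * k).choose k : ℤ)
  | .C, n => ∑ k ∈ range (n + 1), (n.choose k : ℤ) ^ 2 * ((2 * k).choose k : ℤ)
  | .D, n => ∑ k ∈ range (n + 1), (n.choose k : ℤ) ^ 2 * ((n + k).choose k : ℤ)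
  | .E, n => ∑ k ∈ range (n + 1), 4 ^ (n - 2 * k) *
      (n.choose (2 * k) : ℤ) * ((2 * k).choose k : ℤ) ^ 2
  | .F, n => ∑ k ∈ range (n + 1), (-1) ^ k * 8 ^ (n - k) *
      (n.choose k : ℤ) * ∑ j ∈ range (k + 1), (k.choose j : ℤ) ^ 3
  | .delta, n => ∑ k ∈ range (n + 1), (-1) ^ k * 3 ^ (n - 3 * k) *
      (n.choose (3 * k) : ℤ) * ((n + k).choose k : ℤ) *
      ((3 * k).choose (2 * k) : ℤ) * ((2 * k).choose k : ℤ)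
  | .eta, n => ∑ k ∈ range (n + 1), (-1) ^ k * (n.choose k : ℤ) ^ 3 *
      (intBinom (4 * (n : ℤ) - 5 * (k : ℤ) - 1) (3 * n) +
        intBinom (4 * (n : ℤ) - 5 * (k : ℤ)) (3 * n))
  | .alpha, n => ∑ k ∈ range (n + 1), (n.choose k : ℤ) ^ 2 * ((2 * k).choose k : ℤ) *
      ((2 * n - 2 * k).choose (n - k) : ℤ)
  | .epsilon, n => ∑ k ∈ range (n + 1), (n.choose k : ℤ) ^ 2 * ((2 * k).choose n : ℤ) ^ 2
  | .zeta, n => ∑ k ∈ range (n + 1), ∑ l ∈ range (n + 1), (n.choose k : ℤ) ^ 2 *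
      (n.choose l : ℤ) * (k.choose l : ℤ) * ((k + l).choose n : ℤ)
  | .gamma, n => ∑ k ∈ range (n + 1), (n.choose k : ℤ) ^ 2 * ((n + k).choose k : ℤ) ^ 2
  | .s7, n => ∑ k ∈ range (n + 1), (n.choose k : ℤ) ^ 2 * ((n + k).choose k : ℤ) *
      ((2 * k).choose n : ℤ)
  | .s10, n => ∑ k ∈ range (n + 1), (n.choose k : ℤ) ^ 4
  | .s18, n => ∑ k ∈ range (n + 1), (-1) ^ k * (n.choose k : ℤ) * ((2 * k).choose k : ℤ) *
      ((2 * n - 2 * k).choose (n - k) : ℤ) *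
      (intBinom (2 * (n : ℤ) - 3 * (k : ℤ) - 1) n + intBinom (2 * (n : ℤ) - 3 * (k : ℤ)) n)

/-- The binomial transform `v_n(x)` of an integer sequence `u`, at an integer `x`. -/
def binomialTransform (u : ℕ → ℤ) (x : ℤ) (n : ℕ) : ℤ :=
  ∑ k ∈ range (n + 1), (n.choose k : ℤ) * (-x) ^ (n - k) * u k

/-! Consider sums of `C(n, k) * f n k` over `k`, at `n = p * M` with `p ^ r ∣ p * M`. Terms with `p
∤ k` vanish modulo `p ^ r`. For `k = p * j`, the weight is congruent to `C(M, j)`, which is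
divisible by `p ^ (r - s)` for some `s ≤ r` with `p ^ s ∣ p * j`; hence `f` need only satisfy its
congruence modulo `p ^ s`, where both indices are divisible enough. This is `sum_choose_mul_modEq`.
It shows that the binomial transform preserves the Gauss congruences, and it proves them for each of
the fifteen sequences, once a factor `C(n, k)` is split off and the remaining powers and binomials
are treated by `pow_mul_modEq`, `choose_mul_modEq_of_dvd_top` and `choose_mul_modEq_of_dvd_bot`. In
`B`, `E` and `delta` the weight is `C(n, d * k)` with `d = 2` or `3`, so the prime `p = d` needs
extra divisibility by `d`. -/

/-- If `f` vanishes modulo `m` off the multiples of `p`, only the multiples of `p` contribute. -/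
theorem sum_range_mul_modEq {p : ℕ} (hp : 0 < p) (m : ℤ) (M : ℕ) (f g : ℕ → ℤ)
    (hf : ∀ k, ¬ p ∣ k → m ∣ f k) (hfg : ∀ j ≤ M, f (p * j) ≡ g j [ZMOD m]) :
    ∑ k ∈ range (p * M + 1), f k ≡ ∑ j ∈ range (M + 1), g j [ZMOD m] := by
  have h1 : ∑ k ∈ range (p * M + 1), f k ≡
      ∑ k ∈ (range (p * M + 1)).filter (p ∣ ·), f k [ZMOD m] := by
    rw [← sum_filter_add_sum_filter_not (range (p * M + 1)) (p ∣ ·) f]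
    refine (Int.modEq_iff_dvd.2 ?_)
    rw [sub_add_cancel_left, dvd_neg]
    exact dvd_sum fun k hk => hf k (mem_filter.1 hk).2
  have h2 : ∑ k ∈ (range (p * M + 1)).filter (p ∣ ·), f k =
      ∑ j ∈ range (M + 1), f (p * j) := by
    refine (sum_nbij' (fun j => p * j) (fun k => k / p) ?_ ?_ ?_ ?_ ?_).symm
    · intro j hj
      simp only [mem_filter, mem_range, Nat.lt_succ_iff] at hj ⊢
      exact ⟨Nat.mul_le_mul_left p hj, dvd_mul_right p j⟩
    · intro k hk
      simp only [mem_filter, mem_range, Nat.lt_succ_iff] at hk ⊢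
      exact Nat.div_le_of_le_mul hk.1
    · intro j _
      exact Nat.mul_div_cancel_left j hp
    · intro k hk
      exact Nat.mul_div_cancel' (mem_filter.1 hk).2
    · intro j _
      rfl
  refine h1.trans ?_
  rw [h2]
  refine Int.modEq_iff_dvd.2 ?_
  rw [← sum_sub_distrib]
  exact dvd_sum fun j hj =>
    Int.modEq_iff_dvd.1 (hfg j (Nat.lt_succ_iff.1 (mem_range.1 hj)))

/-- Turns the weight `C(n, d * k)` of `B`, `E` and `delta` into `C(n, l)` with `l = d * k`. -/
theorem sum_range_dvd_reindex {d : ℕ} (hd : 0 < d) (n : ℕ) (f : ℕ → ℤ)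
    (hf : ∀ k, n < d * k → f k = 0) :
    ∑ l ∈ range (n + 1), (if d ∣ l then f (l / d) else 0) = ∑ k ∈ range (n + 1), f k := by
  rw [← sum_filter, ← sum_filter_add_sum_filter_not (range (n + 1)) (fun k => d * k ≤ n) f,
    sum_eq_zero (s := (range (n + 1)).filter fun k => ¬ d * k ≤ n)
      fun k hk => hf k (not_le.1 (mem_filter.1 hk).2), add_zero]
  refine sum_nbij' (fun l => l / d) (fun k => d * k) ?_ ?_ ?_ ?_ ?_
  · intro l hl
    simp only [mem_filter, mem_range, Nat.lt_succ_iff] at hl ⊢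
    exact ⟨(Nat.div_le_self l d).trans hl.1, by rw [Nat.mul_div_cancel' hl.2]; exact hl.1⟩
  · intro k hk
    simp only [mem_filter, mem_range, Nat.lt_succ_iff] at hk ⊢
    exact ⟨hk.2, dvd_mul_right d k⟩
  · intro l hl
    exact Nat.mul_div_cancel' (mem_filter.1 hl).2
  · intro k _
    exact Nat.mul_div_cancel_left k hd
  · intro l _
    rfl

/-! ### Congruences for powers and binomial coefficients -/

theorem pow_mul_modEq {p : ℕ} (hp : p.Prime) {s m : ℕ} (h : p ^ s ∣ p * m) (x : ℤ) :
    x ^ (p * m) ≡ x ^ m [ZMOD (p : ℤ) ^ s] := by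
  rcases s with _ | t
  · simpa using Int.modEq_one
  rw [pow_succ', Nat.mul_dvd_mul_iff_left hp.pos] at h
  obtain ⟨c, rfl⟩ := h
  have := Fact.mk hp
  have hx : (p : ℤ) ∣ x ^ p - x := by
    rw [← ZMod.intCast_zmod_eq_zero_iff_dvd]
    push_cast
    rw [ZMod.pow_card, sub_self]
  have := dvd_sub_pow_of_dvd_sub hx t
  have h2 : x ^ (p * (p ^ t * c)) = ((x ^ p) ^ p ^ t) ^ c := by ring
  have h3 : x ^ (p ^ t * c) = (x ^ p ^ t) ^ c := by ring
  rw [h2, h3]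
  exact ((Int.modEq_iff_dvd.2 this).symm).pow c

/-- Raising `(1 + X) ^ p ≡ 1 + X ^ p` modulo `p` to the power `p ^ t` gives a congruence modulo `p ^
(t + 1)`; coefficients are then compared. -/
theorem choose_mul_modEq_of_dvd_top {p : ℕ} (hp : p.Prime) {s a : ℕ} (h : p ^ s ∣ p * a)
    (b : ℕ) : ((p * a).choose (p * b) : ℤ) ≡ a.choose b [ZMOD (p : ℤ) ^ s] := by
  rcases s with _ | t
  · simpa using Int.modEq_one
  rw [pow_succ', Nat.mul_dvd_mul_iff_left hp.pos] at h
  obtain ⟨c, rfl⟩ := h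
  open Polynomial in
  have hx : ((p : ℕ) : ℤ[X]) ∣ (1 + X) ^ p - (1 + X ^ p) := by
    obtain ⟨r, hr⟩ := exists_add_pow_prime_eq hp (1 : ℤ[X]) X
    rw [hr]
    exact ⟨1 * X * r, by ring⟩
  have h1 := (dvd_sub_pow_of_dvd_sub hx t).trans (sub_dvd_pow_sub_pow _ _ c)
  obtain ⟨q, hq⟩ := h1
  have h2 := congrArg (fun P => Polynomial.coeff P (p * b)) hq
  simp only [Polynomial.coeff_sub] at h2
  rw [← pow_mul, ← pow_mul, ← pow_mul, Polynomial.coeff_one_add_X_pow] at h2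
  have h3 : ((1 + Polynomial.X ^ p : Polynomial ℤ)) ^ (p ^ t * c) =
      Polynomial.expand ℤ p ((1 + Polynomial.X) ^ (p ^ t * c)) := by simp
  rw [h3, mul_comm p b, Polynomial.coeff_expand_mul hp.pos, Polynomial.coeff_one_add_X_pow] at h2
  refine (Int.modEq_iff_dvd.2 ?_).symm
  rw [mul_comm p b, h2]
  have h4 : ((p : ℕ) : Polynomial ℤ) ^ (t + 1) = Polynomial.C ((p : ℤ) ^ (t + 1)) := by simp
  rw [h4, Polynomial.coeff_C_mul]
  exact dvd_mul_right _ _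

theorem pow_dvd_choose_of_not_dvd {p : ℕ} (hp : p.Prime) {r N k : ℕ} (h : p ^ r ∣ N)
    (hk : ¬ p ∣ k) : p ^ r ∣ N.choose k := by
  rcases k with _ | k
  · simp at hk
  rcases N with _ | N
  · simp
  have := Nat.add_one_mul_choose_eq N k
  refine (Nat.Coprime.pow_left r ((Nat.Prime.coprime_iff_not_dvd hp).2 hk)).dvd_of_dvd_mul_right ?_
  rw [← this]
  exact h.mul_right _

/-- Since `j * C(M, j) = M * C(M - 1, j - 1)`, the power `p ^ r` divides `(p * j) * C(M, j)` and
splits between the two factors. -/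
theorem exists_pow_dvd_and_pow_sub_dvd_choose {p : ℕ} (hp : p.Prime) {r M : ℕ}
    (h : p ^ r ∣ p * M) (j : ℕ) :
    ∃ s ≤ r, p ^ s ∣ p * j ∧ p ^ (r - s) ∣ M.choose j := by
  rcases j with _ | j
  · exact ⟨r, le_rfl, by simp, by simp⟩
  rcases M with _ | M
  · exact ⟨0, Nat.zero_le r, by simp, by simp⟩
  have h1 : p ^ r ∣ (p * (j + 1)) * (M + 1).choose (j + 1) := by
    rw [mul_assoc, mul_comm (j + 1), ← Nat.add_one_mul_choose_eq, ← mul_assoc]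
    exact h.mul_right _
  obtain ⟨d, e, hd, he, hde⟩ := exists_dvd_and_dvd_of_dvd_mul h1
  obtain ⟨s, hs, rfl⟩ := (Nat.dvd_prime_pow hp).1 (⟨e, hde⟩ : d ∣ p ^ r)
  refine ⟨s, hs, hd, ?_⟩
  have : p ^ (r - s) = e := by
    refine Nat.eq_of_mul_eq_mul_left (pow_pos hp.pos s) ?_
    rw [← hde, ← pow_add, Nat.add_sub_cancel' hs]
  rwa [this]

/-- Sums weighted by `C(N, k)` with `p ^ r ∣ N` reduce modulo `p ^ r` to sums over `k / p`. -/
theorem sum_choose_mul_modEq {p : ℕ} (hp : p.Prime) {r M : ℕ} (h : p ^ r ∣ p * M)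
    (f g : ℕ → ℤ)
    (hfg : ∀ j ≤ M, ∀ s ≤ r, p ^ s ∣ p * M → p ^ s ∣ p * j →
      f (p * j) ≡ g j [ZMOD (p : ℤ) ^ s]) :
    ∑ k ∈ range (p * M + 1), ((p * M).choose k : ℤ) * f k ≡
      ∑ j ∈ range (M + 1), (M.choose j : ℤ) * g j [ZMOD (p : ℤ) ^ r] := by
  refine sum_range_mul_modEq hp.pos _ M _ _ (fun k hk => ?_) fun j hj => ?_
  · exact Dvd.dvd.mul_right (by exact_mod_cast pow_dvd_choose_of_not_dvd hp h hk) _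
  -- `C(M, j)` supplies `p ^ (r - s)` and the congruence of `f` the remaining `p ^ s`.
  obtain ⟨s, hs, h1, h2⟩ := exists_pow_dvd_and_pow_sub_dvd_choose hp h j
  refine ((choose_mul_modEq_of_dvd_top hp h j).mul_right _).trans ?_
  refine (Int.modEq_iff_dvd.2 ?_)
  rw [← mul_sub, ← Nat.sub_add_cancel hs, pow_add]
  exact mul_dvd_mul (by exact_mod_cast h2)
    (Int.modEq_iff_dvd.1 (hfg j hj s hs ((pow_dvd_pow p hs).trans h) h1))

theorem choose_add_eq_sum_range (n k : ℕ) :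
    ((k + n).choose k : ℤ) =
      ∑ i ∈ range (k + 1), (k.choose i : ℤ) * (n.choose (k - i) : ℤ) := by
  rw [Nat.add_choose_eq, Finset.Nat.sum_antidiagonal_eq_sum_range_succ_mk]
  push_cast
  rfl

/-- The case `e = 0` concerns `C(p a, p b)`, the case `e = 1` concerns `C(p a - 1, p b)`. -/
theorem choose_mul_sub_modEq_of_dvd_bot {p : ℕ} (hp : p.Prime) {e : ℕ} (he : e ≤ 1) (a : ℕ) :
    ∀ b s : ℕ, 0 < b → p ^ s ∣ p * b →
      ((p * a - e).choose (p * b) : ℤ) ≡ (a - e).choose b [ZMOD (p : ℤ) ^ s] := by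
  induction a using Nat.strong_induction_on with
  | _ a ih =>
  intro b s hb h
  have hpp := hp.one_lt
  -- Here both binomials are `0`, or both are `1` when `a = b` and `e = 0`.
  by_cases hab : a < b + e
  · have h0 : (a - e).choose b = if a = b ∧ e = 0 then 1 else 0 := by
      split_ifs with hc
      · simp [hc.1, hc.2]
      · exact Nat.choose_eq_zero_of_lt (by omega)
    have h1 : (p * a - e).choose (p * b) = if a = b ∧ e = 0 then 1 else 0 := by
      split_ifs with hc
      · simp [hc.1, hc.2]
      · apply Nat.choose_eq_zero_of_lt
        have h2 : p * a ≤ p * b := Nat.mul_le_mul_left p (by omega)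
        have h3 : 0 < p * b := Nat.mul_pos hp.pos hb
        by_cases he0 : e = 0
        · have : p * a < p * b := Nat.mul_lt_mul_of_pos_left (by omega) hp.pos
          omega
        · omega
    rw [h0, h1]
  push Not at hab
  obtain ⟨c, rfl⟩ : ∃ c, a = b + c := ⟨a - b, by omega⟩
  have hce : e ≤ c := by omega
  have hpc : e ≤ p * c := hce.trans (Nat.le_mul_of_pos_left c hp.pos)
  -- Vandermonde makes `C(b, i)` the weight, and the other factor has upper part `c < a` because `0
  -- < b`, so induction applies.
  rw [mul_add, Nat.add_sub_assoc hpc, Nat.add_sub_assoc hce, choose_add_eq_sum_range,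
    choose_add_eq_sum_range]
  refine sum_choose_mul_modEq hp h _ _ fun j hj t _ h1 h2 => ?_
  rw [← Nat.mul_sub]
  rcases hj.eq_or_lt with rfl | hj
  · simp
  · exact ih c (by omega) (b - j) t (by omega) (by rw [Nat.mul_sub]; exact Nat.dvd_sub h1 h2)

theorem choose_mul_modEq_of_dvd_bot {p : ℕ} (hp : p.Prime) {s b : ℕ} (h : p ^ s ∣ p * b)
    (a : ℕ) : ((p * a).choose (p * b) : ℤ) ≡ a.choose b [ZMOD (p : ℤ) ^ s] := by
  rcases b.eq_zero_or_pos with rfl | hb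
  · simp
  · exact choose_mul_sub_modEq_of_dvd_bot hp (Nat.zero_le 1) a b s hb h

/-- By symmetry the lower index can be taken to be `a`, the one known to be divisible. -/
theorem choose_mul_add_modEq {p : ℕ} (hp : p.Prime) {s a : ℕ} (h : p ^ s ∣ p * a)
    (b : ℕ) : ((p * a + p * b).choose (p * b) : ℤ) ≡ (a + b).choose b [ZMOD (p : ℤ) ^ s] := by
  have := choose_mul_modEq_of_dvd_bot hp h (a + b)
  rwa [mul_add, Nat.choose_symm_add, Nat.choose_symm_add] at this

theorem centralBinom_mul_modEq {p : ℕ} (hp : p.Prime) {s a : ℕ} (h : p ^ s ∣ p * a) :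
    ((2 * (p * a)).choose (p * a) : ℤ) ≡ (2 * a).choose a [ZMOD (p : ℤ) ^ s] := by
  rw [mul_left_comm]
  exact choose_mul_modEq_of_dvd_bot hp h _

/-! ### Gauss congruences for sums weighted by binomial coefficients -/

/-- The Gauss congruences of a sequence of integers. -/
def SatisfiesGauss (u : ℕ → ℤ) : Prop :=
  ∀ p : ℕ, p.Prime → ∀ r M : ℕ, p ^ r ∣ p * M → u (p * M) ≡ u M [ZMOD (p : ℤ) ^ r]

theorem SatisfiesGauss.of_choose_mul {u : ℕ → ℤ} (f : ℕ → ℕ → ℤ)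
    (hu : ∀ n, u n = ∑ k ∈ range (n + 1), (n.choose k : ℤ) * f n k)
    (hf : ∀ p : ℕ, p.Prime → ∀ M j s : ℕ, 0 < M → j ≤ M → p ^ s ∣ p * M → p ^ s ∣ p * j →
      f (p * M) (p * j) ≡ f M j [ZMOD (p : ℤ) ^ s]) :
    SatisfiesGauss u := by
  intro p hp r M h
  rcases M.eq_zero_or_pos with rfl | hM
  · simp
  rw [hu, hu]
  exact sum_choose_mul_modEq hp h _ _ fun j hj s _ h1 h2 => hf p hp M j s hM hj h1 h2

theorem pow_mul_sub_modEq {p : ℕ} (hp : p.Prime) {s M j : ℕ} (h : p ^ s ∣ p * M)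
    (h' : p ^ s ∣ p * j) (x : ℤ) :
    x ^ (p * M - p * j) ≡ x ^ (M - j) [ZMOD (p : ℤ) ^ s] := by
  rw [← Nat.mul_sub]
  exact pow_mul_modEq hp (by rw [Nat.mul_sub]; exact Nat.dvd_sub h h') x

theorem SatisfiesGauss.binomialTransform {u : ℕ → ℤ} (hu : SatisfiesGauss u) (x : ℤ) :
    SatisfiesGauss (binomialTransform u x) := by
  refine .of_choose_mul (fun n k => (-x) ^ (n - k) * u k) (fun n => ?_)
    fun p hp M j s _ _ h h' => (pow_mul_sub_modEq hp h h' _).mul (hu p hp s j h')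
  exact sum_congr rfl fun k _ => by ring

theorem satisfiesGauss_sum_choose_pow (e : ℕ) :
    SatisfiesGauss fun n => ∑ k ∈ range (n + 1), (n.choose k : ℤ) ^ (e + 1) :=
  .of_choose_mul (fun n k => (n.choose k : ℤ) ^ e)
    (fun n => sum_congr rfl fun k _ => by ring)
    fun p hp M j s _ _ h _ => (choose_mul_modEq_of_dvd_top hp h j).pow e

theorem satisfiesGauss_C : SatisfiesGauss AperyLike.C.seq :=
  .of_choose_mul (fun n k => (n.choose k : ℤ) * ((2 * k).choose k : ℤ))
    (fun n => sum_congr rfl fun k _ => by ring)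
    fun p hp M j s _ _ h h' =>
      (choose_mul_modEq_of_dvd_top hp h j).mul (centralBinom_mul_modEq hp h')

theorem satisfiesGauss_D : SatisfiesGauss AperyLike.D.seq :=
  .of_choose_mul (fun n k => (n.choose k : ℤ) * ((n + k).choose k : ℤ))
    (fun n => sum_congr rfl fun k _ => by ring)
    fun p hp M j s _ _ h _ =>
      (choose_mul_modEq_of_dvd_top hp h j).mul (choose_mul_add_modEq hp h j)

theorem satisfiesGauss_gamma : SatisfiesGauss AperyLike.gamma.seq :=
  .of_choose_mul (fun n k => (n.choose k : ℤ) * ((n + k).choose k : ℤ) ^ 2)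
    (fun n => sum_congr rfl fun k _ => by ring)
    fun p hp M j s _ _ h _ =>
      (choose_mul_modEq_of_dvd_top hp h j).mul ((choose_mul_add_modEq hp h j).pow 2)

theorem two_mul_choose_mul_modEq {p : ℕ} (hp : p.Prime) {s M : ℕ} (h : p ^ s ∣ p * M) (j : ℕ) :
    ((2 * (p * j)).choose (p * M) : ℤ) ≡ (2 * j).choose M [ZMOD (p : ℤ) ^ s] := by
  rw [mul_left_comm]
  exact choose_mul_modEq_of_dvd_bot hp h _

theorem satisfiesGauss_epsilon : SatisfiesGauss AperyLike.epsilon.seq :=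
  .of_choose_mul (fun n k => (n.choose k : ℤ) * ((2 * k).choose n : ℤ) ^ 2)
    (fun n => sum_congr rfl fun k _ => by ring)
    fun p hp M j s _ _ h _ =>
      (choose_mul_modEq_of_dvd_top hp h j).mul ((two_mul_choose_mul_modEq hp h j).pow 2)

theorem satisfiesGauss_s7 : SatisfiesGauss AperyLike.s7.seq :=
  .of_choose_mul
    (fun n k => (n.choose k : ℤ) * ((n + k).choose k : ℤ) * ((2 * k).choose n : ℤ))
    (fun n => sum_congr rfl fun k _ => by ring)
    fun p hp M j s _ _ h _ =>
      ((choose_mul_modEq_of_dvd_top hp h j).mul (choose_mul_add_modEq hp h j)).mul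
        (two_mul_choose_mul_modEq hp h j)

theorem centralBinom_sub_mul_modEq {p : ℕ} (hp : p.Prime) {s M j : ℕ} (h : p ^ s ∣ p * M)
    (h' : p ^ s ∣ p * j) :
    ((2 * (p * M) - 2 * (p * j)).choose (p * M - p * j) : ℤ) ≡
      (2 * M - 2 * j).choose (M - j) [ZMOD (p : ℤ) ^ s] := by
  rw [← Nat.mul_sub, ← Nat.mul_sub, ← Nat.mul_sub]
  exact centralBinom_mul_modEq hp (by rw [Nat.mul_sub]; exact Nat.dvd_sub h h')

theorem satisfiesGauss_alpha : SatisfiesGauss AperyLike.alpha.seq :=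
  .of_choose_mul
    (fun n k => (n.choose k : ℤ) * ((2 * k).choose k : ℤ) * ((2 * n - 2 * k).choose (n - k) : ℤ))
    (fun n => sum_congr rfl fun k _ => by ring)
    fun p hp M j s _ _ h h' =>
      ((choose_mul_modEq_of_dvd_top hp h j).mul (centralBinom_mul_modEq hp h')).mul
        (centralBinom_sub_mul_modEq hp h h')

theorem satisfiesGauss_zeta : SatisfiesGauss AperyLike.zeta.seq := by
  refine .of_choose_mul
    (fun n k => ∑ l ∈ range (n + 1), (n.choose l : ℤ) *
      ((n.choose k : ℤ) * (k.choose l : ℤ) * ((k + l).choose n : ℤ)))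
    (fun n => sum_congr rfl fun k _ => ?_) fun p hp M j s _ _ h h' => ?_
  · rw [mul_sum]
    exact sum_congr rfl fun l _ => by ring
  -- The inner sum is itself weighted by `C(n, l)`, so the reduction applies a second time.
  · refine sum_choose_mul_modEq hp h _ _ fun l _ t ht h1 h2 => ?_
    refine ((choose_mul_modEq_of_dvd_top hp h1 j).mul
      (choose_mul_modEq_of_dvd_bot hp h2 j)).mul ?_
    rw [← mul_add]
    exact choose_mul_modEq_of_dvd_bot hp h1 (j + l)

theorem satisfiesGauss_F : SatisfiesGauss AperyLike.F.seq :=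
  .of_choose_mul
    (fun n k => (-1) ^ k * 8 ^ (n - k) * ∑ j ∈ range (k + 1), (k.choose j : ℤ) ^ 3)
    (fun n => sum_congr rfl fun k _ => by ring)
    fun p hp M j s _ _ h h' =>
      ((pow_mul_modEq hp h' _).mul (pow_mul_sub_modEq hp h h' _)).mul
        (satisfiesGauss_sum_choose_pow 2 p hp s j h')

/-! ### Integer upper arguments: `eta` and `s18` -/

/-- For a positive lower index, truncating a negative upper argument to `0` also gives `0`; at lower
index `0` it would give `1`. -/
theorem intBinom_of_pos (m : ℤ) {k : ℕ} (hk : 0 < k) : intBinom m k = m.toNat.choose k := by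
  unfold intBinom
  split_ifs with h
  · rfl
  · rw [Int.toNat_of_nonpos (by omega), Nat.choose_eq_zero_of_lt hk, Nat.cast_zero]

theorem intBinom_mul_sub_modEq {p : ℕ} (hp : p.Prime) {s b : ℕ} (hb : 0 < b)
    (h : p ^ s ∣ p * b) {e : ℕ} (he : e ≤ 1) (a : ℤ) :
    intBinom (p * a - e) (p * b) ≡ intBinom (a - e) b [ZMOD (p : ℤ) ^ s] := by
  rw [intBinom_of_pos _ hb, intBinom_of_pos _ (Nat.mul_pos hp.pos hb)]
  have h1 : (a - e).toNat = a.toNat - e := by omega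
  have h2 : (p * a - e).toNat = p * a.toNat - e := by
    rcases le_total 0 a with ha | ha
    · lift a to ℕ using ha
      rw [Int.toNat_natCast, ← Nat.cast_mul]
      omega
    · have : (p : ℤ) * a ≤ 0 := mul_nonpos_of_nonneg_of_nonpos (by positivity) ha
      rw [Int.toNat_of_nonpos ha]
      omega
  rw [h1, h2]
  exact choose_mul_sub_modEq_of_dvd_bot hp he _ b s hb h

theorem intBinom_add_mul_modEq {p : ℕ} (hp : p.Prime) {s b : ℕ} (hb : 0 < b)
    (h : p ^ s ∣ p * b) (a : ℤ) :
    intBinom (p * a - 1) (p * b) + intBinom (p * a) (p * b) ≡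
      intBinom (a - 1) b + intBinom a b [ZMOD (p : ℤ) ^ s] := by
  have h1 := intBinom_mul_sub_modEq hp hb h le_rfl a
  have h0 := intBinom_mul_sub_modEq hp hb h (Nat.zero_le 1) a
  rw [Nat.cast_one] at h1
  rw [Nat.cast_zero, sub_zero, sub_zero] at h0
  exact h1.add h0

theorem satisfiesGauss_eta : SatisfiesGauss AperyLike.eta.seq := by
  refine .of_choose_mul
    (fun n k => (-1) ^ k * (n.choose k : ℤ) ^ 2 *
      (intBinom (4 * (n : ℤ) - 5 * (k : ℤ) - 1) (3 * n) +
        intBinom (4 * (n : ℤ) - 5 * (k : ℤ)) (3 * n)))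
    (fun n => sum_congr rfl fun k _ => by ring) fun p hp M j s hM _ h h' => ?_
  refine ((pow_mul_modEq hp h' _).mul ((choose_mul_modEq_of_dvd_top hp h j).pow 2)).mul ?_
  have h1 : 4 * ((p * M : ℕ) : ℤ) - 5 * ((p * j : ℕ) : ℤ) = p * (4 * (M : ℤ) - 5 * (j : ℤ)) := by
    push_cast
    ring
  rw [h1, mul_left_comm 3 p M]
  exact intBinom_add_mul_modEq hp (by omega)
    (by rw [mul_left_comm]; exact h.mul_left 3) _

theorem satisfiesGauss_s18 : SatisfiesGauss AperyLike.s18.seq := by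
  refine .of_choose_mul
    (fun n k => (-1) ^ k * ((2 * k).choose k : ℤ) * ((2 * n - 2 * k).choose (n - k) : ℤ) *
      (intBinom (2 * (n : ℤ) - 3 * (k : ℤ) - 1) n + intBinom (2 * (n : ℤ) - 3 * (k : ℤ)) n))
    (fun n => sum_congr rfl fun k _ => by ring) fun p hp M j s hM _ h h' => ?_
  refine (((pow_mul_modEq hp h' _).mul (centralBinom_mul_modEq hp h')).mul
    (centralBinom_sub_mul_modEq hp h h')).mul ?_
  have h1 : 2 * ((p * M : ℕ) : ℤ) - 3 * ((p * j : ℕ) : ℤ) = p * (2 * (M : ℤ) - 3 * (j : ℤ)) := by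
    push_cast
    ring
  rw [h1]
  exact intBinom_add_mul_modEq hp hM h _

/-! ### Sequences supported on multiples of 2 or 3: `E`, `B` and `delta` -/

/-- The Gauss congruences of a sequence supported on the multiples of a prime `d`. -/
theorem ite_dvd_modEq {d p : ℕ} (hd : d.Prime) (hp : p.Prime) {s j : ℕ} (h : p ^ s ∣ p * j)
    (f g : ℕ → ℤ) (h0 : ∀ i, 0 < i → (d : ℤ) ∣ f i)
    (hfg : ∀ i, p ^ s ∣ p * (d * i) → f (p * i) ≡ g i [ZMOD (p : ℤ) ^ s]) :
    (if d ∣ p * j then f (p * j / d) else 0) ≡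
      (if d ∣ j then g (j / d) else 0) [ZMOD (p : ℤ) ^ s] := by
  by_cases hj : d ∣ j
  · obtain ⟨i, rfl⟩ := hj
    rw [if_pos (dvd_mul_right d i), if_pos (by rw [mul_left_comm]; exact dvd_mul_right _ _),
      mul_left_comm, Nat.mul_div_cancel_left _ hd.pos, Nat.mul_div_cancel_left _ hd.pos]
    exact hfg i h
  · rw [if_neg hj]
    split_ifs with hpj
    -- Only the left side survives; `d ∤ j` forces `s ≤ 1`, so divisibility of `f j` by `d`
    -- suffices.
    · have hdp : d = p :=
        (Nat.prime_dvd_prime_iff_eq hd hp).1 ((hd.dvd_mul.1 hpj).resolve_right hj)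
      subst hdp
      have hs : s ≤ 1 := by
        by_contra! hs
        have h2 : d ^ 2 ∣ d * j := (pow_dvd_pow d hs).trans h
        rw [sq, Nat.mul_dvd_mul_iff_left hd.pos] at h2
        exact hj h2
      refine Int.modEq_zero_iff_dvd.2 ((pow_dvd_pow (d : ℤ) hs).trans ?_)
      rw [pow_one]
      rw [Nat.mul_div_cancel_left j hp.pos]
      exact h0 j (Nat.pos_of_ne_zero fun hj0 => hj (hj0 ▸ dvd_zero d))
    · rfl

theorem satisfiesGauss_E : SatisfiesGauss AperyLike.E.seq := by
  refine .of_choose_mul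
    (fun n l => 4 ^ (n - l) * if 2 ∣ l then ((2 * (l / 2)).choose (l / 2) : ℤ) ^ 2 else 0)
    (fun n => ?_) fun p hp M j s _ _ h h' => ?_
  · refine (sum_range_dvd_reindex two_pos n _ fun k hk => ?_).symm.trans
      (sum_congr rfl fun l _ => ?_)
    · simp [Nat.choose_eq_zero_of_lt hk]
    · split_ifs with hl
      · rw [Nat.mul_div_cancel' hl]
        ring
      · simp
  · refine (pow_mul_sub_modEq hp h h' _).mul (ite_dvd_modEq Nat.prime_two hp h'
      (fun i => ((2 * i).choose i : ℤ) ^ 2) (fun i => ((2 * i).choose i : ℤ) ^ 2) ?_ ?_)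
    · intro i hi
      exact Dvd.dvd.pow (by exact_mod_cast Nat.two_dvd_centralBinom_of_one_le hi) two_ne_zero
    · intro i hi
      -- The divisible index is the upper one, `2 * i`, so `p = 2` loses no factor.
      have := choose_mul_modEq_of_dvd_top hp hi i
      rw [mul_left_comm] at this
      exact this.pow 2

/-- `C(3i, 2i) = C(3i, i) = 3 * C(3i - 1, i - 1)`. -/
theorem three_dvd_choose {i : ℕ} (hi : 0 < i) : 3 ∣ (3 * i).choose (2 * i) := by
  obtain ⟨m, rfl⟩ : ∃ m, i = m + 1 := ⟨i - 1, by omega⟩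
  have h1 : (3 * (m + 1)).choose (2 * (m + 1)) = (3 * (m + 1)).choose (m + 1) :=
    Nat.choose_symm_of_eq_add (by ring)
  have h2 := Nat.add_one_mul_choose_eq (3 * m + 2) m
  refine ⟨(3 * m + 2).choose m, Nat.eq_of_mul_eq_mul_left (Nat.succ_pos m) ?_⟩
  rw [h1, Nat.succ_eq_add_one, mul_comm (m + 1)]
  refine h2.symm.trans ?_
  ring

/-- The factor common to the sequences `B` and `delta`. -/
def signedTrinomial (i : ℕ) : ℤ :=
  (-1) ^ i * ((3 * i).choose (2 * i) : ℤ) * ((2 * i).choose i : ℤ)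

theorem three_dvd_signedTrinomial {i : ℕ} (hi : 0 < i) : (3 : ℤ) ∣ signedTrinomial i :=
  Dvd.dvd.mul_right (Dvd.dvd.mul_left (by exact_mod_cast three_dvd_choose hi) _) _

theorem signedTrinomial_mul_modEq {p : ℕ} (hp : p.Prime) {s i : ℕ} (h : p ^ s ∣ p * (3 * i)) :
    signedTrinomial (p * i) ≡ signedTrinomial i [ZMOD (p : ℤ) ^ s] := by
  have hsign : (-1 : ℤ) ^ (p * i) ≡ (-1) ^ i [ZMOD (p : ℤ) ^ s] := by
    have h3 : ∀ m : ℕ, (-1 : ℤ) ^ (3 * m) = (-1) ^ m := fun m => by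
      rw [pow_mul]
      norm_num
    have := pow_mul_modEq hp h (-1)
    rwa [mul_left_comm, h3, h3] at this
  have htop : ((3 * (p * i)).choose (2 * (p * i)) : ℤ) ≡ (3 * i).choose (2 * i)
      [ZMOD (p : ℤ) ^ s] := by
    rw [mul_left_comm, mul_left_comm 2]
    exact choose_mul_modEq_of_dvd_top hp h _
  unfold signedTrinomial
  rw [mul_assoc, mul_assoc]
  refine hsign.mul ((htop.mul_right _).trans ?_)
  -- For `p = 3` the central binomial congruence holds one power of `3` short; `C(3i, 2i)` provides
  -- the missing factor.
  by_cases hp3 : p = 3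
  · subst hp3
    rcases s with _ | t
    · simpa using Int.modEq_one
    rcases i.eq_zero_or_pos with rfl | hi
    · rfl
    rw [pow_succ', Nat.mul_dvd_mul_iff_left three_pos] at h
    refine Int.modEq_iff_dvd.2 ?_
    rw [← mul_sub, pow_succ']
    exact mul_dvd_mul (by exact_mod_cast three_dvd_choose hi)
      (Int.modEq_iff_dvd.1 (centralBinom_mul_modEq hp h))
  · refine (centralBinom_mul_modEq hp ?_).mul_left _
    rw [mul_left_comm] at h
    exact (Nat.Coprime.pow_left s
      ((Nat.coprime_primes hp Nat.prime_three).2 hp3)).dvd_of_dvd_mul_left h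

theorem satisfiesGauss_B : SatisfiesGauss AperyLike.B.seq := by
  refine .of_choose_mul
    (fun n l => 3 ^ (n - l) * if 3 ∣ l then signedTrinomial (l / 3) else 0)
    (fun n => ?_) fun p hp M j s _ _ h h' => ?_
  · refine (sum_range_dvd_reindex three_pos n _ fun k hk => ?_).symm.trans
      (sum_congr rfl fun l _ => ?_)
    · simp [Nat.choose_eq_zero_of_lt hk]
    · split_ifs with hl
      · rw [signedTrinomial, Nat.mul_div_cancel' hl]
        ring
      · simp
  · exact (pow_mul_sub_modEq hp h h' _).mul (ite_dvd_modEq Nat.prime_three hp h' _ _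
      (fun i hi => three_dvd_signedTrinomial hi) fun i hi => signedTrinomial_mul_modEq hp hi)

theorem satisfiesGauss_delta : SatisfiesGauss AperyLike.delta.seq := by
  refine .of_choose_mul
    (fun n l => 3 ^ (n - l) *
      if 3 ∣ l then signedTrinomial (l / 3) * ((n + l / 3).choose (l / 3) : ℤ) else 0)
    (fun n => ?_) fun p hp M j s _ _ h h' => ?_
  · refine (sum_range_dvd_reindex three_pos n _ fun k hk => ?_).symm.trans
      (sum_congr rfl fun l _ => ?_)
    · simp [Nat.choose_eq_zero_of_lt hk]
    · split_ifs with hl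
      · rw [signedTrinomial, Nat.mul_div_cancel' hl]
        ring
      · simp
  · exact (pow_mul_sub_modEq hp h h' _).mul (ite_dvd_modEq Nat.prime_three hp h'
      -- The summand depends on `n`, so the functions at levels `p * M` and `M` differ.
      (fun i => signedTrinomial i * ((p * M + i).choose i : ℤ))
      (fun i => signedTrinomial i * ((M + i).choose i : ℤ))
      (fun i hi => (three_dvd_signedTrinomial hi).mul_right _)
      fun i hi => (signedTrinomial_mul_modEq hp hi).mul (choose_mul_add_modEq hp h i))

/-! ### Conclusion for all fifteen sequences -/

theorem AperyLike.satisfiesGauss_seq : ∀ S : AperyLike, SatisfiesGauss S.seq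
  | .A => satisfiesGauss_sum_choose_pow 2
  | .B => satisfiesGauss_B
  | .C => satisfiesGauss_C
  | .D => satisfiesGauss_D
  | .E => satisfiesGauss_E
  | .F => satisfiesGauss_F
  | .delta => satisfiesGauss_delta
  | .eta => satisfiesGauss_eta
  | .alpha => satisfiesGauss_alpha
  | .epsilon => satisfiesGauss_epsilon
  | .zeta => satisfiesGauss_zeta
  | .gamma => satisfiesGauss_gamma
  | .s7 => satisfiesGauss_s7
  | .s10 => satisfiesGauss_sum_choose_pow 3
  | .s18 => satisfiesGauss_s18

theorem mainTheorem3 (S : AperyLike) (α : ℤ) (p : ℕ) (hp : p.Prime)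
    (n k : ℕ) (hn : 1 ≤ n) (hk : 1 ≤ k) :
    binomialTransform S.seq α (n * p ^ k) ≡ binomialTransform S.seq α (n * p ^ (k - 1))
      [ZMOD (p : ℤ) ^ k] := by
  have h : n * p ^ k = p * (n * p ^ (k - 1)) := by
    rw [mul_left_comm, mul_pow_sub_one (by omega)]
  rw [h]
  exact (S.satisfiesGauss_seq.binomialTransform α) p hp k _ (h ▸ dvd_mul_left _ _)
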